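/- For a set $C$ and $n\ge 1$ let $\binom{C}{n}$ be the set of $n$-element subsets of $C$. Let $L_0=\{E_n : 0<n<\omega\}$, where $E_n$ is a relation symbol of arity $2n$, and let $\mathcal K_0$ be the class of all finite $L_0$-structures $C$ in which every $E_n$ is given by an equivalence relation on $\binom{C}{n}$: for some equivalence relation $\sim_n$ on $\binom{C}{n}$, $E_n(x_1,\dots,x_n,y_1,\dots,y_n)$ holds iff the $x_i$ are pairwise distinct, the $y_i$ are pairwise distinct, and $\{x_1,\dots,x_n\}\sim_n\{y_1,\dots,y_n\}$. The class $\mathcal K_0$ has a Fraïssé limit, i.e. there is a countable ultrahomogeneous structure $M_0$ (unique up to isomorphism) whose age, the class of finite structures that embed into it, is $\mathcal K_0$. It satisfies the following. (a) $M_0$ has Hrushovski's extension property: for every finite family of isomorphisms between finite substructures of $M_0$ there is a finite substructure $F$ of $M_0$ which contains all these substructures and is such that every isomorphism in the family extends to an automorphism of $F$. Moreover, the group $\mathrm{Aut}(M_0)$, with the topology of pointwise convergence, is amenable: every continuous action of it on a nonempty compact Hausdorff space has an invariant Borel probability measure. (b) There is no linear order $<$ on $M_0$ such that $\mathrm{Th}(M_0,<)$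 admits elimination of quantifiers and the age of $(M_0,<)$ has the Ramsey property. Here a class $\mathcal K$ of finite structures has the Ramsey property if for all $k$ and all $A,B\in\mathcal K$ such that $A$ embeds into $B$ there is $C\in\mathcal K$ such that for every $k$-coloring of the substructures of $C$ isomorphic to $A$ there is a substructure $B'$ of $C$, isomorphic to $B$, such that all substructures of $B'$ isomorphic to $A$ have the same color. The same already holds for the $\{E_1,E_2\}$-reduct $M_{12}$ of $M_0$: the group $\mathrm{Aut}(M_{12})$ is amenable, and there is no linear order $<$ on $M_{12}$ such that $\mathrm{Th}(M_{12},<)$ admits elimination of quantifiers and the age of $(M_{12},<)$ has the Ramsey property. -/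

import Mathlib

open FirstOrder FirstOrder.Language
universe u v

namespace EqSubsets

/-! ### Relational languages with symbols `E_n` of arity `2n` -/

/-- One relation symbol `E n`, of arity `n + n`, for each `n ∈ S`. -/
inductive EqRel (S : Set ℕ) : ℕ → Type
  | E (n : ℕ) (hn : n ∈ S) : EqRel S (n + n)

/-- The relational language `{E_n : n ∈ S}`. -/
def eqLang (S : Set ℕ) : Language := ⟨fun _ => Empty, EqRel S⟩

instance (S : Set ℕ) : (eqLang S).IsRelational :=
  fun _ => inferInstanceAs (IsEmpty Empty)

/-- The language `L₀ = {E_n : 0 < n}`. -/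
abbrev L₀ : Language := eqLang {n | 0 < n}

/-- The language `{E_1, E_2}`. -/
abbrev L₁₂ : Language := eqLang {1, 2}

/-- The inclusion of `{E_1, E_2}` into `L₀`. -/
def incl : L₁₂ →ᴸ L₀ where
  onFunction _ f := f
  onRelation
    | _, .E n hn => .E n (by
        rcases hn with h | h
        · exact h ▸ Nat.one_pos
        · exact h ▸ Nat.two_pos)

/-- The class of all finite `{E_n : n ∈ S}`-structures in which, for each `n ∈ S`, the relation
`E_n` is given by an equivalence relation on the set of unordered `n`-element subsets:
`E_n(x̄, ȳ)` holds iff neither `x̄` nor `ȳ` has a repetition and the underlying sets of `x̄` and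
`ȳ` are equivalent. -/
def eqClass (S : Set ℕ) : Set (CategoryTheory.Bundled.{u} (eqLang S).Structure) :=
  {C | Finite C ∧ ∀ (n : ℕ) (hn : n ∈ S), ∃ r : Setoid {s : Finset C // s.card = n},
    ∀ x y : Fin n → C,
      Structure.RelMap (L := eqLang S) (EqRel.E n hn) (Fin.append x y) ↔
        ∃ (hx : Function.Injective x) (hy : Function.Injective y),
          r ⟨Finset.univ.map ⟨x, hx⟩, by simp⟩ ⟨Finset.univ.map ⟨y, hy⟩, by simp⟩}

/-- The class `K₀` of finite `L₀`-structures. -/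
abbrev K₀ : Set (CategoryTheory.Bundled.{u} L₀.Structure) := eqClass {n | 0 < n}

/-! ### Extension property for partial isomorphisms -/

/-- Hrushovski's extension property: for every finite family of isomorphisms between finite
substructures of `M` there is a finite substructure `F` of `M` that contains all these
substructures and such that every member of the family extends to an automorphism of `F`. -/
def HrushovskiProperty (L : Language) (M : Type u) [L.Structure M] : Prop :=
  ∀ P : Set (M ≃ₚ[L] M), P.Finite → (∀ p ∈ P, (p.dom : Set M).Finite) →
    ∃ F : L.Substructure M, (F : Set M).Finite ∧
      ∀ p ∈ P, p.dom ≤ F ∧ p.cod ≤ F ∧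
        ∃ g : F ≃[L] F, ∀ (x : M) (hx : x ∈ p.dom) (hxF : x ∈ F),
          (g ⟨x, hxF⟩ : M) = p.toEquiv ⟨x, hx⟩

/-! ### Automorphism groups and amenability -/

/-- The automorphism group of a structure, as a group of permutations. -/
def Aut (L : Language) (M : Type u) [L.Structure M] : Subgroup (Equiv.Perm M) where
  carrier := {σ | ∃ g : M ≃[L] M, g.toEquiv = σ}
  one_mem' := ⟨Language.Equiv.refl L M, rfl⟩
  mul_mem' := by
    rintro _ _ ⟨g, rfl⟩ ⟨h, rfl⟩
    exact ⟨g.comp h, rfl⟩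
  inv_mem' := by
    rintro _ ⟨g, rfl⟩
    exact ⟨g.symm, rfl⟩

/-- The topology of pointwise convergence on the automorphism group, `M` being discrete. -/
instance (L : Language) (M : Type u) [L.Structure M] : TopologicalSpace (Aut L M) :=
  TopologicalSpace.induced (fun (g : Aut L M) (x : M) => (g : Equiv.Perm M) x)
    (@Pi.topologicalSpace M (fun _ => M) (fun _ => ⊥))

/-- `G` is amenable: every continuous action of `G` on a (nonempty) compact Hausdorff space
preserves a Borel probability measure. -/
def Amenable (G : Type u) [Group G] [TopologicalSpace G] : Prop :=
  ∀ (X : Type v) [TopologicalSpace X] [CompactSpace X] [T2Space X] [Nonempty X]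
    [MeasurableSpace X] [BorelSpace X] [MulAction G X] [ContinuousSMul G X],
    ∃ μ : MeasureTheory.Measure X,
      MeasureTheory.IsProbabilityMeasure μ ∧ MeasureTheory.SMulInvariantMeasure G X μ

/-! ### Ramsey property, quantifier elimination, expansions by linear orders -/

/-- The set of all substructures of `C` that are isomorphic to `A`. -/
def Copies (L : Language) (A C : Type u) [L.Structure A] [L.Structure C] :
    Set (L.Substructure C) :=
  {S | Nonempty (A ≃[L] S)}

/-- The Ramsey property of a class of structures: for all `k` and all `A`, `B` in the class such
that `A` embeds into `B` there is `C` in the class with `C → (B)^A_k`. -/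
def RamseyProperty {L : Language} (K : Set (CategoryTheory.Bundled.{u} L.Structure)) : Prop :=
  ∀ (k : ℕ), ∀ A ∈ K, ∀ B ∈ K, Nonempty (A ↪[L] B) →
    ∃ C ∈ K, ∀ ξ : Copies L A C → Fin k,
      ∃ B' ∈ Copies L B C, ∃ c : Fin k, ∀ S : Copies L A C, (S : L.Substructure C) ≤ B' → ξ S = c

/-- Every formula is equivalent modulo `T` to a quantifier-free formula in the same variables. -/
def EliminatesQuantifiers {L : Language} (T : L.Theory) : Prop :=
  ∀ (n : ℕ) (φ : L.Formula (Fin n)), ∃ ψ : L.Formula (Fin n),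
    BoundedFormula.IsQF ψ ∧ φ ⇔[T] ψ

/-- The expansion of an `L`-structure by a linear order of its underlying set. -/
abbrev orderExpansion (L : Language) (M : Type u) [L.Structure M] (o : LinearOrder M) :
    (L.sum Language.order).Structure M :=
  letI : Language.order.Structure M := Language.orderStructure M
  Language.sumStructure L Language.order M

/-- `M` has an expansion `(M, <)` by a linear order such that `Th(M, <)` eliminates quantifiers and
the age of `(M, <)` has the Ramsey property. -/
def HasRamseyOrderExpansion (L : Language) (M : Type u) [L.Structure M] : Prop :=
  ∃ o : LinearOrder M,
    letI : (L.sum Language.order).Structure M := orderExpansion L M o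
    EliminatesQuantifiers ((L.sum Language.order).completeTheory M) ∧
      RamseyProperty ((L.sum Language.order).age M)

end EqSubsets

namespace EqSubsets

/-! ### Structures given by colorings of finite subsets -/

section Coloring

/-! A structure is encoded by a coloring of its finite subsets in which two `n`-sets, `n ∈ S`, are
`E_n`-equivalent iff they have the same color. Embeddings are then the injections that preserve and
reflect equality of colors (`IsColoring.embedding`, `IsColoring.eq_iff`). A countable colored
structure with the one-point extension property is a Fraïssé limit. One is built on `ℕ`
(`exists_isFraisseLimit`), and the `{E_1, E_2}`-reduct of a limit is again a limit
(`isFraisseLimit_reduct`), so the remaining arguments are run for a general index set `S`.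

Extension property: a finite `W ⊆ M` is placed in a finite hull whose points are pairs of some `w ∈
W` and a family of vectors over F_2, one for each subset of `W`. A set projecting injectively onto
`s ⊆ W` is colored by the sum of its vectors at `s`. Translations whose sum over every `s` vanishes
do not change colors, and they leave enough freedom to extend every partial isomorphism of `W`
(`hrushovskiProperty`). For ultrahomogeneous relational structures this property yields amenability:
averaging over the automorphism group of a finite substructure gives almost invariant measures, and
a weak limit of these is invariant (`amenable_aut`).

Failure of Ramsey: a linear order on `M` does not order the `E_2`-classes. Split the pairs of a
pentagon into edges and diagonals. The greatest vertex together with its two neighbors, and together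
with its two non-neighbors, gives isomorphic ordered triples in which the two classes trade roles.
Enumerate the `E_2`-classes of `M` and color a triple by which of its classes comes first; then no
copy of the pentagon is monochromatic (`not_ramseyProperty_age_orderExpansion`). -/

theorem comp_append {α β : Type*} (f : α → β) {m n : ℕ} (x : Fin m → α) (y : Fin n → α) :
    f ∘ Fin.append x y = Fin.append (f ∘ x) (f ∘ y) := by
  ext i
  refine Fin.addCases (fun i => ?_) (fun i => ?_) i <;>
    simp only [Function.comp_apply, Fin.append_left, Fin.append_right]

theorem exists_map_univ_eq {C : Type*} (s : Finset C) {n : ℕ} (h : s.card = n) :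
    ∃ (x : Fin n → C) (hx : Function.Injective x), Finset.univ.map ⟨x, hx⟩ = s := by
  subst h
  refine ⟨fun i => s.equivFin.symm i, Subtype.val_injective.comp s.equivFin.symm.injective, ?_⟩
  ext a
  simp only [Finset.mem_map, Finset.mem_univ, true_and, Function.Embedding.coeFn_mk]
  exact ⟨by rintro ⟨i, rfl⟩; simp, fun ha => ⟨s.equivFin ⟨a, ha⟩, by simp⟩⟩

open scoped Classical in
/-- The coloring obtained from `c` by distinguishing sets of different cardinalities and
identifying those of the same cardinality outside of `S`. -/
noncomputable def normalizeColor {C κ : Type*} (S : Set ℕ) (c : Finset C → κ) (s : Finset C) :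
    ℕ × Option κ :=
  (s.card, if s.card ∈ S then some (c s) else none)

theorem normalizeColor_eq_iff {C D κ : Type*} {S : Set ℕ} {c : Finset C → κ} {d : Finset D → κ}
    {s : Finset C} {t : Finset D} :
    normalizeColor S c s = normalizeColor S d t ↔
      s.card = t.card ∧ (s.card ∈ S → c s = d t) := by
  unfold normalizeColor
  rw [Prod.mk.injEq]
  refine and_congr_right fun h => ?_
  rw [← h]
  by_cases hs : s.card ∈ S <;> simp [hs]

/-- The relations `E_n` are given by equality of colors. -/
structure IsColoring (S : Set ℕ) {C : Type*} [(eqLang S).Structure C] {κ : Type*}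
    (c : Finset C → κ) : Prop where
  rel : ∀ (n : ℕ) (hn : n ∈ S) (x y : Fin n → C),
    Structure.RelMap (L := eqLang S) (EqRel.E n hn) (Fin.append x y) ↔
      ∃ (hx : Function.Injective x) (hy : Function.Injective y),
        c (Finset.univ.map ⟨x, hx⟩) = c (Finset.univ.map ⟨y, hy⟩)
  card_eq : ∀ {s t}, c s = c t → s.card = t.card
  eq_of_notMem : ∀ {s t}, s.card = t.card → s.card ∉ S → c s = c t

variable {S : Set ℕ} {C : Type*} {κ : Type*}

theorem isColoring_normalizeColor [(eqLang S).Structure C] {c : Finset C → κ}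
    (h : ∀ (n : ℕ) (hn : n ∈ S) (x y : Fin n → C),
      Structure.RelMap (L := eqLang S) (EqRel.E n hn) (Fin.append x y) ↔
      ∃ (hx : Function.Injective x) (hy : Function.Injective y),
        c (Finset.univ.map ⟨x, hx⟩) = c (Finset.univ.map ⟨y, hy⟩)) :
    IsColoring S (normalizeColor S c) where
  rel n hn x y := by
    rw [h]
    simp [normalizeColor_eq_iff, hn]
  card_eq h := (normalizeColor_eq_iff.1 h).1
  eq_of_notMem h h' := normalizeColor_eq_iff.2 ⟨h, fun h'' => absurd h'' h'⟩

/-- The structure given by a coloring. -/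
@[reducible] def colorStructure (S : Set ℕ) (c : Finset C → κ) : (eqLang S).Structure C where
  funMap f := isEmptyElim f
  RelMap := fun {_} r => match r with
    | .E n _ => fun z => ∃ (hx : Function.Injective fun i => z (Fin.castAdd n i))
        (hy : Function.Injective fun i => z (Fin.natAdd n i)),
        c (Finset.univ.map ⟨_, hx⟩) = c (Finset.univ.map ⟨_, hy⟩)

theorem isColoring_colorStructure (S : Set ℕ) (c : Finset C → κ) :
    letI := colorStructure S c
    IsColoring S (normalizeColor S c) := by
  let := colorStructure S c
  refine isColoring_normalizeColor fun n hn x y => ?_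
  change (∃ (_ : Function.Injective fun i => Fin.append x y (Fin.castAdd n i))
        (_ : Function.Injective fun i => Fin.append x y (Fin.natAdd n i)), _) ↔ _
  simp only [Fin.append_left, Fin.append_right]

variable {D : Type*} {μ : Type*} [(eqLang S).Structure C] [(eqLang S).Structure D]
  {c : Finset C → κ} {d : Finset D → μ}

/-- An injection which respects the colorings is an embedding. -/
def IsColoring.embedding (hc : IsColoring S c) (hd : IsColoring S d) (f : C ↪ D)
    (h : ∀ s t, c s = c t ↔ d (s.map f) = d (t.map f)) : C ↪[eqLang S] D where
  toEmbedding := f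
  map_fun' g := isEmptyElim g
  map_rel' := by
    rintro _ ⟨n, hn⟩ z
    obtain ⟨x, y, rfl⟩ : ∃ x y : Fin n → C, z = Fin.append x y :=
      ⟨_, _, Fin.append_castAdd_natAdd.symm⟩
    have e : f.toFun ∘ Fin.append x y = Fin.append (f ∘ x) (f ∘ y) := comp_append _ _ _
    rw [e, hc.rel, hd.rel]
    constructor
    · rintro ⟨hx, hy, e⟩
      refine ⟨hx.of_comp, hy.of_comp, (h _ _).2 ?_⟩
      rw [Finset.map_map, Finset.map_map]
      exact e
    · rintro ⟨hx, hy, e⟩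
      refine ⟨f.injective.comp hx, f.injective.comp hy, ?_⟩
      have := (h _ _).1 e
      rw [Finset.map_map, Finset.map_map] at this
      exact this

/-- The relations only compare sets of equal size in `S`. The fields `card_eq` and `eq_of_notMem`
settle all other comparisons, so the structure determines the whole partition by color. -/
theorem IsColoring.eq_iff (hc : IsColoring S c) (hd : IsColoring S d) (f : C ↪[eqLang S] D)
    (s t : Finset C) : c s = c t ↔ d (s.map f.toEmbedding) = d (t.map f.toEmbedding) := by
  by_cases hst : s.card = t.card
  swap
  · refine iff_of_false (fun h => hst (hc.card_eq h)) fun h => hst ?_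
    simpa using hd.card_eq h
  by_cases hn : s.card ∈ S
  swap
  · exact iff_of_true (hc.eq_of_notMem hst hn)
      (hd.eq_of_notMem (by simpa using hst) (by simpa using hn))
  obtain ⟨x, hx, hxs⟩ := exists_map_univ_eq s rfl
  obtain ⟨y, hy, hyt⟩ := exists_map_univ_eq t hst.symm
  have h1 := hc.rel _ hn x y
  have h2 := hd.rel _ hn (f ∘ x) (f ∘ y)
  have e : f ∘ Fin.append x y = Fin.append (f ∘ x) (f ∘ y) := comp_append _ _ _
  have h3 := f.map_rel (EqRel.E _ hn : (eqLang S).Relations _) (Fin.append x y)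
  rw [e, h1, h2] at h3
  rw [← hxs, ← hyt, Finset.map_map, Finset.map_map]
  constructor
  · intro h
    obtain ⟨_, _, h⟩ := h3.2 ⟨hx, hy, h⟩
    exact h
  · intro h
    obtain ⟨_, _, h⟩ := h3.1 ⟨f.injective.comp hx, f.injective.comp hy, h⟩
    exact h

theorem IsColoring.comap (hd : IsColoring S d) (f : C ↪[eqLang S] D) :
    IsColoring S fun s : Finset C => d (s.map f.toEmbedding) where
  rel n hn x y := by
    have e : f ∘ Fin.append x y = Fin.append (f ∘ x) (f ∘ y) := comp_append _ _ _
    have h := f.map_rel (EqRel.E n hn : (eqLang S).Relations _) (Fin.append x y)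
    rw [e, hd.rel] at h
    rw [← h]
    simp only [Finset.map_map]
    exact ⟨fun ⟨hx, hy, h⟩ => ⟨hx.of_comp, hy.of_comp, h⟩,
      fun ⟨hx, hy, h⟩ => ⟨f.injective.comp hx, f.injective.comp hy, h⟩⟩
  card_eq h := by simpa using hd.card_eq h
  eq_of_notMem h h' := hd.eq_of_notMem (by simpa using h) (by simpa using h')

/-- Recoloring by an injection. -/
theorem IsColoring.comp_injective {ν : Type*} (hc : IsColoring S c) {φ : κ → ν}
    (hφ : ∀ s t, φ (c s) = φ (c t) → c s = c t) : IsColoring S fun s => φ (c s) where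
  rel n hn x y := by
    rw [hc.rel]
    exact ⟨fun ⟨hx, hy, h⟩ => ⟨hx, hy, congrArg φ h⟩, fun ⟨hx, hy, h⟩ => ⟨hx, hy, hφ _ _ h⟩⟩
  card_eq h := hc.card_eq (hφ _ _ h)
  eq_of_notMem h h' := congrArg φ (hc.eq_of_notMem h h')

theorem IsColoring.exists_nat [Countable C] (hc : IsColoring S c) :
    ∃ c' : Finset C → ℕ, IsColoring S c' := by
  have := (Set.countable_range c).to_subtype
  obtain ⟨φ, hφ⟩ := Countable.exists_injective_nat (Set.range c)
  exact ⟨fun s => Function.extend (Subtype.val : Set.range c → κ) φ 0 (c s),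
    hc.comp_injective fun s t h => by
      have e (s) : c s = ((⟨c s, s, rfl⟩ : Set.range c) : κ) := rfl
      rw [e s, e t, Subtype.val_injective.extend_apply, Subtype.val_injective.extend_apply] at h
      exact congrArg Subtype.val (hφ h)⟩

end Coloring

theorem mem_eqClass_of_isColoring {S : Set ℕ} {C : Type u} [(eqLang S).Structure C] [Finite C]
    {κ : Type*} {c : Finset C → κ} (hc : IsColoring S c) :
    (⟨C, ‹_›⟩ : CategoryTheory.Bundled.{u} (eqLang S).Structure) ∈ eqClass.{u} S :=
  ⟨‹_›, fun n hn => ⟨Setoid.ker fun s : {s : Finset C // s.card = n} => c s, hc.rel n hn⟩⟩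

theorem exists_isColoring_of_mem_eqClass {S : Set ℕ} {C : CategoryTheory.Bundled (eqLang S).Structure}
    (hC : C ∈ eqClass.{u} S) : ∃ c : Finset C → ℕ, IsColoring S c := by
  obtain ⟨hfin, h⟩ := hC
  choose r hr using h
  have key : IsColoring S (normalizeColor S fun s : Finset C =>
      {t | ∃ (n : ℕ) (hn : n ∈ S) (hs : s.card = n) (ht : t.card = n), r n hn ⟨s, hs⟩ ⟨t, ht⟩}) := by
    refine isColoring_normalizeColor fun n hn x y => ?_
    rw [hr]
    refine exists_congr fun hx => exists_congr fun hy => ?_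
    have key (s t : Finset C) (cx : s.card = n) (cy : t.card = n) : r n hn ⟨s, cx⟩ ⟨t, cy⟩ ↔
        {w | ∃ (n : ℕ) (hn : n ∈ S) (hs : s.card = n) (ht : w.card = n),
          r n hn ⟨s, hs⟩ ⟨w, ht⟩} =
        {w | ∃ (n : ℕ) (hn : n ∈ S) (hs : t.card = n) (ht : w.card = n),
          r n hn ⟨t, hs⟩ ⟨w, ht⟩} := by
      constructor
      · intro h
        ext w
        constructor
        · rintro ⟨m, hm, hs, hw, h'⟩
          obtain rfl : n = m := cx.symm.trans hs
          exact ⟨_, hn, cy, hw, (r _ _).trans ((r _ _).symm h) h'⟩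
        · rintro ⟨m, hm, ht, hw, h'⟩
          obtain rfl : n = m := cy.symm.trans ht
          exact ⟨_, hn, cx, hw, (r _ _).trans h h'⟩
      · intro h
        have : t ∈ {w | ∃ (n : ℕ) (hn : n ∈ S) (hs : t.card = n) (ht : w.card = n),
          r n hn ⟨t, hs⟩ ⟨w, ht⟩} := ⟨_, hn, cy, cy, (r _ _).refl _⟩
        rw [← h] at this
        obtain ⟨m, hm, hs, ht, h⟩ := this
        obtain rfl : n = m := cx.symm.trans hs
        exact h
    exact key _ _ _ _
  exact key.exists_nat

/-- The substructure of a relational structure with a given underlying set. -/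
def ofSet {L : Language} [L.IsRelational] {M : Type*} [L.Structure M] (W : Set M) :
    L.Substructure M where
  carrier := W
  fun_mem f := isEmptyElim f

theorem mem_age_of_finite {L : Language} [L.IsRelational] {M : Type u} [L.Structure M] {W : Set M}
    (hW : W.Finite) : ⟨ofSet (L := L) W, inferInstance⟩ ∈ L.age M :=
  ⟨Structure.fg_iff_finite.2 hW, ⟨Substructure.subtype _⟩⟩

/-- The coloring of a structure all of whose finite substructures are in the class. -/
theorem exists_isColoring_of_age_subset {S : Set ℕ} {M : Type u} [(eqLang S).Structure M]
    (h : (eqLang S).age M ⊆ eqClass.{u} S) :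
    ∃ c : Finset M → ℕ × Option (Set (Finset M)), IsColoring S c := by
  let Rel (n : ℕ) (hn : n ∈ S) (x y : Fin n → M) : Prop :=
    Structure.RelMap (L := eqLang S) (EqRel.E n hn) (Fin.append x y)
  -- Only finite substructures are known to lie in the class, so each law of an equivalence relation
  -- is checked on the finitely many points involved.
  have key (W : Set M) (hW : W.Finite) : ∃ c : Finset W → ℕ, ∀ n hn, ∀ x y : Fin n → W,
      Rel n hn (fun i => x i) (fun i => y i) ↔
      ∃ (hx : Function.Injective x) (hy : Function.Injective y),
        c (Finset.univ.map ⟨x, hx⟩) = c (Finset.univ.map ⟨y, hy⟩) := by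
    obtain ⟨c, hc⟩ := exists_isColoring_of_mem_eqClass (h (mem_age_of_finite hW))
    refine ⟨c, fun n hn x y => ?_⟩
    have := (ofSet W : (eqLang S).Substructure M).subtype.map_rel
      (EqRel.E n hn : (eqLang S).Relations _) (Fin.append x y)
    refine Iff.trans (Iff.trans (iff_of_eq ?_) this) (hc.rel n hn x y)
    exact congrArg (Structure.RelMap (L := eqLang S) (EqRel.E n hn))
      (comp_append Subtype.val x y).symm
  have inj {n hn x y} (h : Rel n hn x y) : Function.Injective x ∧ Function.Injective y := by
    obtain ⟨c, hc⟩ := key (Set.range x ∪ Set.range y) (Set.toFinite _)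
    obtain ⟨hx, hy, -⟩ := (hc n hn (fun i => ⟨x i, by simp⟩) (fun i => ⟨y i, by simp⟩)).1 h
    exact ⟨Subtype.val_injective.comp hx, Subtype.val_injective.comp hy⟩
  have symm {n hn x y} (h : Rel n hn x y) : Rel n hn y x := by
    obtain ⟨c, hc⟩ := key (Set.range x ∪ Set.range y) (Set.toFinite _)
    obtain ⟨hx, hy, e⟩ := (hc n hn (fun i => ⟨x i, by simp⟩) (fun i => ⟨y i, by simp⟩)).1 h
    exact (hc n hn (fun i => ⟨y i, by simp⟩) (fun i => ⟨x i, by simp⟩)).2 ⟨hy, hx, e.symm⟩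
  have trans {n hn x y z} (h : Rel n hn x y) (h' : Rel n hn y z) : Rel n hn x z := by
    obtain ⟨c, hc⟩ := key (Set.range x ∪ Set.range y ∪ Set.range z) (Set.toFinite _)
    obtain ⟨hx, hy, e⟩ := (hc n hn (fun i => ⟨x i, by simp⟩) (fun i => ⟨y i, by simp⟩)).1 h
    obtain ⟨_, hz, e'⟩ := (hc n hn (fun i => ⟨y i, by simp⟩) (fun i => ⟨z i, by simp⟩)).1 h'
    exact (hc n hn (fun i => ⟨x i, by simp⟩) (fun i => ⟨z i, by simp⟩)).2 ⟨hx, hz, e.trans e'⟩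
  have refl {n hn} {x y : Fin n → M} (hx : Function.Injective x) (hy : Function.Injective y)
      (e : Finset.univ.map ⟨x, hx⟩ = Finset.univ.map ⟨y, hy⟩) : Rel n hn x y := by
    obtain ⟨c, hc⟩ := key (Set.range x ∪ Set.range y) (Set.toFinite _)
    refine (hc n hn (fun i => ⟨x i, by simp⟩) (fun i => ⟨y i, by simp⟩)).2
      ⟨fun i j h => hx (congrArg Subtype.val h), fun i j h => hy (congrArg Subtype.val h), ?_⟩
    congr 1
    apply Finset.map_injective (Function.Embedding.subtype _)
    rw [Finset.map_map, Finset.map_map]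
    exact e
  -- The color of a set is its own equivalence class.
  refine ⟨_, isColoring_normalizeColor (c := fun s : Finset M =>
    {t | ∃ n hn x y, ∃ (hx : Function.Injective x) (hy : Function.Injective y),
      s = Finset.univ.map ⟨x, hx⟩ ∧ t = Finset.univ.map ⟨y, hy⟩ ∧ Rel n hn x y}) ?_⟩
  intro n hn x y
  change Rel n hn x y ↔ _
  have sub {x y} (h : Rel n hn x y) (hx : Function.Injective x) (hy : Function.Injective y)
      (t : Finset M) (ht : ∃ n hn x' y', ∃ (hx' : Function.Injective x') (hy : Function.Injective y'),
        Finset.univ.map ⟨x, hx⟩ = Finset.univ.map ⟨x', hx'⟩ ∧ t = Finset.univ.map ⟨y', hy⟩ ∧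
          Rel n hn x' y') :
      ∃ n hn x' y', ∃ (hx' : Function.Injective x') (hy' : Function.Injective y'),
        Finset.univ.map ⟨y, hy⟩ = Finset.univ.map ⟨x', hx'⟩ ∧ t = Finset.univ.map ⟨y', hy'⟩ ∧
          Rel n hn x' y' := by
    obtain ⟨m, hm, x', z, hx', hz, e, rfl, h'⟩ := ht
    obtain rfl : n = m := by simpa using congrArg Finset.card e
    exact ⟨n, hn, y, z, hy, hz, rfl, rfl, trans (symm h) (trans (refl hx hx' e) h')⟩
  constructor
  · intro h
    obtain ⟨hx, hy⟩ := inj h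
    exact ⟨hx, hy, Set.ext fun t => ⟨sub h hx hy t, sub (symm h) hy hx t⟩⟩
  · rintro ⟨hx, hy, e⟩
    have : Finset.univ.map ⟨y, hy⟩ ∈ {t | ∃ n hn x' y', ∃ (hx : Function.Injective x')
      (hy' : Function.Injective y'), Finset.univ.map ⟨y, hy⟩ = Finset.univ.map ⟨x', hx⟩ ∧
        t = Finset.univ.map ⟨y', hy'⟩ ∧ Rel n hn x' y'} :=
      ⟨n, hn, y, y, hy, hy, rfl, rfl, refl hy hy rfl⟩
    rw [← e] at this
    obtain ⟨m, hm, x', y', hx', hy', e1, e2, h⟩ := this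
    obtain rfl : n = m := by simpa using congrArg Finset.card e1
    exact trans (refl hx hx' e1) (trans h (refl hy' hy e2.symm))

/-! ### The generic structure -/

/-- Every extension of a finite colored structure by at most one point can be realized in `M`. -/
def OnePointExtension (S : Set ℕ) (M : Type u) [(eqLang S).Structure M] : Prop :=
  ∀ (A T : Type u) [(eqLang S).Structure A] [(eqLang S).Structure T] [Finite T] (d : Finset T → ℕ),
    IsColoring S d → ∀ (i : A ↪[eqLang S] T) (a : T), (∀ x, x ≠ a → x ∈ Set.range i) →
      ∀ f : A ↪[eqLang S] M, ∃ g : T ↪[eqLang S] M, f = g.comp i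

theorem OnePointExtension.isExtensionPair {S : Set ℕ} {M N : Type u} [(eqLang S).Structure M]
    [(eqLang S).Structure N] (h : OnePointExtension S M) {κ : Type*} {c : Finset N → κ}
    (hc : IsColoring S c) : (eqLang S).IsExtensionPair N M := by
  rw [isExtensionPair_iff_exists_embedding_closure_singleton_sup]
  intro A hA f m
  have : Finite (Substructure.closure (eqLang S) {m} ⊔ A : (eqLang S).Substructure N) :=
    ((Substructure.fg_closure_singleton m).sup hA).finite
  obtain ⟨d, hd⟩ := (hc.comap
    (Substructure.closure (eqLang S) {m} ⊔ A : (eqLang S).Substructure N).subtype).exists_nat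
  refine h _ _ d hd (Substructure.inclusion le_sup_right) ⟨m, ?_⟩ ?_ f
  · exact (le_sup_left : Substructure.closure (eqLang S) {m} ≤ _ ⊔ A)
      (Substructure.subset_closure rfl)
  · rintro ⟨x, hx⟩ hxm
    have hx' : x ∈ Substructure.closure (eqLang S) ({m} ∪ (A : Set N)) := by
      rwa [Substructure.closure_union, Substructure.closure_eq]
    rw [Substructure.mem_closure_iff_of_isRelational] at hx'
    rcases hx' with rfl | hx'
    · exact absurd rfl hxm
    · exact ⟨⟨x, hx'⟩, rfl⟩

/-- Extending partial maps point by point from `M` to itself gives ultrahomogeneity. Doing so from a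
member of the class, starting with the empty map, shows that it embeds. -/
theorem OnePointExtension.isFraisseLimit {S : Set ℕ} {M : Type u} [(eqLang S).Structure M]
    [Countable M] (h : OnePointExtension S M) {κ : Type*} {c : Finset M → κ}
    (hc : IsColoring S c) : IsFraisseLimit (eqClass.{u} S) M where
  ultrahomogeneous :=
    (isUltrahomogeneous_iff_IsExtensionPair Structure.cg_of_countable).2 (h.isExtensionPair hc)
  age := by
    ext N
    constructor
    · rintro ⟨hN, ⟨e⟩⟩
      have : Finite N := hN.finite
      exact mem_eqClass_of_isColoring (hc.comap e)
    · intro hN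
      obtain ⟨d, hd⟩ := exists_isColoring_of_mem_eqClass hN
      have : Finite N := hN.1
      refine ⟨Structure.fg_iff_finite.2 this, ?_⟩
      let B : (eqLang S).Substructure N := ofSet ∅
      have hB : IsEmpty B := ⟨fun x => x.2⟩
      let e : B ↪[eqLang S] M := (hd.comap B.subtype).embedding hc ⟨isEmptyElim, isEmptyElim⟩
        fun s t => by simp [Subsingleton.elim s t]
      obtain ⟨f, -⟩ := embedding_from_cg Structure.cg_of_countable
        ⟨⟨B, _, e.equivRange⟩, Substructure.fg_iff_finite.2 inferInstance⟩ (h.isExtensionPair hd)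
      exact ⟨f⟩

/-- A coloring of the finite sets of natural numbers in which every assignment of colors
to the sets with maximal element `m` occurs for some `m`. -/
noncomputable def genericColor (u : Finset ℕ) : ℕ :=
  (exists_surjective_nat (Finset ℕ →₀ ℕ)).choose (u.sup id).unpair.2 (u.erase (u.sup id))

theorem exists_genericColor_insert_eq (A : Finset ℕ) (τ : Finset ℕ → ℕ) :
    ∃ m, (∀ x ∈ A, x < m) ∧ ∀ s ⊆ A, genericColor (insert m s) = τ s := by
  classical
  obtain ⟨j, hj⟩ := (exists_surjective_nat (Finset ℕ →₀ ℕ)).choose_spec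
    (Finsupp.onFinset A.powerset (fun s => if s ∈ A.powerset then τ s else 0)
      fun s hs => by by_contra h; simp [h] at hs)
  -- In `m = Nat.pair (A.sup id + 1) j` the first coordinate forces `m` above `A`, and the second is
  -- a code of `τ`.
  have hm : ∀ x ∈ A, x < Nat.pair (A.sup id + 1) j := fun x hx =>
    ((Finset.le_sup (f := id) hx).trans_lt (Nat.lt_succ_self _)).trans_le (Nat.left_le_pair _ _)
  refine ⟨_, hm, fun s hs => ?_⟩
  have hsup : (insert (Nat.pair (A.sup id + 1) j) s).sup id = Nat.pair (A.sup id + 1) j := by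
    rw [Finset.sup_insert]
    exact sup_eq_left.2 (Finset.sup_le fun x hx => (hm x (hs hx)).le)
  rw [genericColor, hsup, Nat.unpair_pair, hj,
    Finset.erase_insert fun h => (hm _ (hs h)).false, Finsupp.onFinset_apply,
    if_pos (Finset.mem_powerset.2 hs)]

theorem exists_isFraisseLimit (S : Set ℕ) :
    ∃ (M : Type u) (_ : (eqLang S).Structure M) (_ : Countable M),
      IsFraisseLimit (eqClass.{u} S) M := by
  classical
  let C (s : Finset (ULift.{u} ℕ)) : ℕ := genericColor (s.map Equiv.ulift.toEmbedding)
  let := colorStructure S C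
  have hC := isColoring_colorStructure S C
  refine ⟨ULift.{u} ℕ, this, inferInstance, OnePointExtension.isFraisseLimit ?_ hC⟩
  intro A T _ _ _ d hd i a ha f
  have : Finite A := Finite.of_injective i i.injective
  have := Fintype.ofFinite A
  have := Fintype.ofFinite T
  have hf (s t : Finset A) (hst : s.card = t.card) (hs : s.card ∈ S) :
      d (s.map i.toEmbedding) = d (t.map i.toEmbedding) ↔
        C (s.map f.toEmbedding) = C (t.map f.toEmbedding) := by
    rw [(hd.comap i).eq_iff hC f, normalizeColor_eq_iff]
    simp [hst, hst ▸ hs]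
  -- The map `φ n` translates colors of `n`-sets of `T` into colors of `M`. It is forced on colors
  -- occurring inside the image of `A`; every other color goes above `N`, out of reach of the forced
  -- values, so `φ n` is injective.
  obtain ⟨N, hN⟩ := (Set.finite_range fun s : Finset A => C (s.map f.toEmbedding)).bddAbove
  let φ (n k : ℕ) : ℕ := if h : ∃ s : Finset A, s.card = n ∧ d (s.map i.toEmbedding) = k then
    C (h.choose.map f.toEmbedding) else N + 1 + k
  have φ_map (s : Finset A) (hs : s.card ∈ S) :
      φ s.card (d (s.map i.toEmbedding)) = C (s.map f.toEmbedding) := by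
    have h : ∃ s' : Finset A, s'.card = s.card ∧ d (s'.map i.toEmbedding) = d (s.map i.toEmbedding) :=
      ⟨s, rfl, rfl⟩
    simp only [φ, dif_pos h]
    exact (hf _ _ h.choose_spec.1 (by rwa [h.choose_spec.1])).1 h.choose_spec.2
  have φ_inj (n : ℕ) (hn : n ∈ S) (k l : ℕ) (h : φ n k = φ n l) : k = l := by
    by_cases hk : ∃ s : Finset A, s.card = n ∧ d (s.map i.toEmbedding) = k <;>
    by_cases hl : ∃ s : Finset A, s.card = n ∧ d (s.map i.toEmbedding) = l
    · obtain ⟨s, rfl, rfl⟩ := hk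
      obtain ⟨t, ht, rfl⟩ := hl
      rw [φ_map s hn, ← ht, φ_map t (ht ▸ hn)] at h
      exact (hf _ _ ht.symm hn).2 h
    · obtain ⟨s, rfl, rfl⟩ := hk
      have := hN ⟨s, rfl⟩
      rw [φ_map s hn] at h
      simp only [φ, dif_neg hl] at h
      simp only at this
      omega
    · obtain ⟨s, rfl, rfl⟩ := hl
      have := hN ⟨s, rfl⟩
      rw [φ_map s hn] at h
      simp only [φ, dif_neg hk] at h
      simp only at this
      omega
    · simp only [φ, dif_neg hk, dif_neg hl] at h
      omega
  let f' : A ↪ ℕ := f.toEmbedding.trans Equiv.ulift.toEmbedding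
  -- The new point `m` is to play the role of `a`; `u.card + 1` is the size of `insert m u`. If `a`
  -- already lies in the range of `i`, then `m` is not used by `g`.
  obtain ⟨m, hm, hmτ⟩ := exists_genericColor_insert_eq (Finset.univ.map f') fun u =>
    φ (u.card + 1) (d (insert a ((Finset.univ.filter fun x => f' x ∈ u).map i.toEmbedding)))
  let g : T → ULift.{u} ℕ := Function.extend i f fun _ => ⟨m⟩
  have gi (x : A) : g (i x) = f x := i.injective.extend_apply _ _ x
  have ga (h : a ∉ Set.range i) : g a = ⟨m⟩ := Function.extend_apply' _ _ _ h
  have hne (x : A) : f x ≠ ⟨m⟩ := fun h =>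
    (hm (f' x) (Finset.mem_map_of_mem _ (Finset.mem_univ x))).ne (congrArg ULift.down h)
  have g_inj : Function.Injective g := by
    intro x y h
    by_cases hx : x ∈ Set.range i <;> by_cases hy : y ∈ Set.range i
    · obtain ⟨x, rfl⟩ := hx
      obtain ⟨y, rfl⟩ := hy
      rw [gi, gi] at h
      rw [f.injective h]
    · obtain ⟨x, rfl⟩ := hx
      obtain rfl : y = a := by by_contra h; exact hy (ha _ h)
      rw [gi, ga hy] at h
      exact absurd h (hne x)
    · obtain ⟨y, rfl⟩ := hy
      obtain rfl : x = a := by by_contra h; exact hx (ha _ h)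
      rw [gi, ga hx] at h
      exact absurd h.symm (hne y)
    · have : x = a := by by_contra h; exact hx (ha _ h)
      have : y = a := by by_contra h; exact hy (ha _ h)
      simp [*]
  have key (s : Finset T) (hs : s.card ∈ S) : C (s.map ⟨g, g_inj⟩) = φ s.card (d s) := by
    obtain ⟨s', hs'⟩ : ∃ s' : Finset A, s' = Finset.univ.filter fun x => i x ∈ s := ⟨_, rfl⟩
    have hmap : (s'.map i.toEmbedding).map ⟨g, g_inj⟩ = s'.map f.toEmbedding := by
      rw [Finset.map_map]
      congr 1
      ext x
      exact congrArg ULift.down (gi x)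
    by_cases has : a ∈ s ∧ a ∉ Set.range i
    · have hins : s = insert a (s'.map i.toEmbedding) := by
        ext x
        simp only [hs', Finset.mem_insert, Finset.mem_map, Finset.mem_filter, Finset.mem_univ,
          true_and]
        constructor
        · intro hx
          by_cases hxa : x = a
          · exact Or.inl hxa
          · obtain ⟨y, rfl⟩ := ha x hxa
            exact Or.inr ⟨y, hx, rfl⟩
        · rintro (rfl | ⟨y, hy, rfl⟩)
          exacts [has.1, hy]
      have hcard : s.card = s'.card + 1 := by
        rw [hins, Finset.card_insert_of_notMem, Finset.card_map]
        intro h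
        obtain ⟨y, -, hy⟩ := Finset.mem_map.1 h
        exact has.2 ⟨y, hy⟩
      have hfil : (Finset.univ.filter fun x => f' x ∈ s'.map f') = s' := by
        ext x
        simp
      have h := hmτ (s'.map f') (Finset.map_subset_map.2 (Finset.subset_univ _))
      rw [hfil, Finset.card_map, ← hcard, ← hins] at h
      rw [← h, hins, Finset.map_insert, hmap]
      simp only [C, Finset.map_insert, Finset.map_map, Function.Embedding.coeFn_mk, ga has.2]
      rfl
    · have hins : s = s'.map i.toEmbedding := by
        ext x
        simp only [hs', Finset.mem_map, Finset.mem_filter, Finset.mem_univ, true_and]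
        constructor
        · intro hx
          have : x ∈ Set.range i := by
            by_cases hxa : x = a
            · subst hxa
              by_contra h
              exact has ⟨hx, h⟩
            · exact ha x hxa
          obtain ⟨y, rfl⟩ := this
          exact ⟨y, hx, rfl⟩
        · rintro ⟨y, hy, rfl⟩
          exact hy
      rw [hins, hmap, Finset.card_map, φ_map]
      rwa [hins, Finset.card_map] at hs
  refine ⟨hd.embedding hC ⟨g, g_inj⟩ fun s t => ?_, ?_⟩
  · rw [normalizeColor_eq_iff, Finset.card_map, Finset.card_map]
    constructor
    · intro h
      have hst := hd.card_eq h
      exact ⟨hst, fun hs => by rw [key s hs, key t (hst ▸ hs), h, hst]⟩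
    · rintro ⟨hst, h⟩
      by_cases hs : s.card ∈ S
      · have := h hs
        rw [key s hs, key t (hst ▸ hs), ← hst] at this
        exact φ_inj _ hs _ _ this
      · exact hd.eq_of_notMem hst hs
  · ext x
    exact congrArg ULift.down (gi x).symm

/-! ### The reduct to `{E_1, E_2}` -/

theorem pos_of_mem_one_two {n : ℕ} (hn : n ∈ ({1, 2} : Set ℕ)) : n ∈ {n : ℕ | 0 < n} := by
  rcases hn with rfl | rfl <;> simp

theorem isColoring_reduct {M : Type*} [L₀.Structure M] {κ : Type*} {c : Finset M → κ}
    (hc : IsColoring {n | 0 < n} c) :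
    letI : L₁₂.Structure M := incl.reduct M
    IsColoring {1, 2} (normalizeColor {1, 2} c) := by
  let : L₁₂.Structure M := incl.reduct M
  exact isColoring_normalizeColor fun n hn x y => hc.rel n (pos_of_mem_one_two hn) x y

/-- A one-point extension problem for `{E_1, E_2}` lifts to one for `L₀`: `A` takes all colors of
its image in `M`, and `T` is given compatible colors in the remaining sizes. The limit `M` solves
the lifted problem. -/
theorem isFraisseLimit_reduct {M : Type u} [L₀.Structure M] [Countable M]
    (hM : IsFraisseLimit K₀.{u} M) :
    letI : L₁₂.Structure M := incl.reduct M
    IsFraisseLimit (eqClass.{u} {1, 2}) M := by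
  classical
  obtain ⟨c, hc⟩ := exists_isColoring_of_age_subset hM.age.le
  let : L₁₂.Structure M := incl.reduct M
  have hc' := isColoring_reduct hc
  refine OnePointExtension.isFraisseLimit ?_ hc'
  intro A T _ _ _ d hd i a ha f
  have : Finite A := Finite.of_injective i i.injective
  let cA (s : Finset A) := c (s.map f.toEmbedding)
  -- Sizes 1 and 2 are colored by `d`. In other sizes, sets from `A` keep their color and all
  -- remaining sets share the value `none`.
  let cT (s : Finset T) : ℕ ⊕ Option (ℕ × Option (Set (Finset M))) :=
    if s.card ∈ ({1, 2} : Set ℕ) then .inl (d s)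
    else .inr (if h : ∃ s' : Finset A, s'.map i.toEmbedding = s then some (cA h.choose) else none)
  let sA : L₀.Structure A := colorStructure _ cA
  let sT : L₀.Structure T := colorStructure _ cT
  have hA : IsColoring {n | 0 < n} (normalizeColor {n | 0 < n} cA) := isColoring_colorStructure _ cA
  have hT : IsColoring {n | 0 < n} (normalizeColor {n | 0 < n} cT) := isColoring_colorStructure _ cT
  have cT_map (s : Finset A) (hs : s.card ∉ ({1, 2} : Set ℕ)) :
      cT (s.map i.toEmbedding) = .inr (some (cA s)) := by
    have h : ∃ s' : Finset A, s'.map i.toEmbedding = s.map i.toEmbedding := ⟨s, rfl⟩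
    simp only [cT, Finset.card_map, if_neg hs, dif_pos h]
    rw [Finset.map_injective _ h.choose_spec]
  let f₀ : A ↪[L₀] M := hA.embedding hc f.toEmbedding fun s t => by
    rw [normalizeColor_eq_iff]
    constructor
    · rintro ⟨hst, h⟩
      by_cases hs : s.card ∈ {n | 0 < n}
      · exact h hs
      · exact hc.eq_of_notMem (by simpa using hst) (by simpa using hs)
    · intro h
      exact ⟨by simpa using hc.card_eq h, fun _ => h⟩
  let i₀ : A ↪[L₀] T := hA.embedding hT i.toEmbedding fun s t => by
    rw [normalizeColor_eq_iff, normalizeColor_eq_iff, Finset.card_map, Finset.card_map]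
    refine and_congr_right fun hst => imp_congr_right fun hs => ?_
    by_cases hs2 : s.card ∈ ({1, 2} : Set ℕ)
    · have h := (hd.comap i).eq_iff hc' f s t
      rw [normalizeColor_eq_iff, Finset.card_map, Finset.card_map] at h
      simp only [cT, Finset.card_map, if_pos hs2, if_pos (hst ▸ hs2 : t.card ∈ ({1, 2} : Set ℕ)),
        Sum.inl.injEq]
      rw [h]
      simp [hst, cA, hst ▸ hs2]
    · rw [cT_map s hs2, cT_map t (hst ▸ hs2)]
      simp
  have hTM : Nonempty (T ↪[L₀] M) := by
    have : (⟨T, sT⟩ : CategoryTheory.Bundled L₀.Structure) ∈ L₀.age M := by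
      rw [hM.age]
      exact mem_eqClass_of_isColoring hT
    exact this.2
  obtain ⟨g, hg⟩ := hM.ultrahomogeneous.extend_embedding (Structure.fg_iff_finite.2 ‹Finite A›) f₀ i₀
  refine ⟨hd.embedding hc' g.toEmbedding fun s t => ?_, ?_⟩
  · have h := hT.eq_iff hc g s t
    rw [normalizeColor_eq_iff]
    by_cases hst : s.card = t.card
    swap
    · exact iff_of_false (fun h => hst (hd.card_eq h)) fun h => hst (by simpa using h.1)
    by_cases hs2 : s.card ∈ ({1, 2} : Set ℕ)
    swap
    · exact iff_of_true (hd.eq_of_notMem hst hs2)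
        ⟨by simpa using hst, fun h => absurd h (by simpa using hs2)⟩
    rw [← h, normalizeColor_eq_iff]
    simp only [cT, if_pos hs2, if_pos (hst ▸ hs2 : t.card ∈ ({1, 2} : Set ℕ)), Sum.inl.injEq,
      Finset.card_map]
    have := pos_of_mem_one_two hs2
    tauto
  · ext x
    exact DFunLike.congr_fun hg x

/-! ### The extension property -/

theorem exists_perm_apply_eq {ι K : Type*} [Finite K] {u v : ι → K}
    (h : ∀ i j, u i = u j ↔ v i = v j) : ∃ χ : Equiv.Perm K, ∀ i, χ (u i) = v i := by
  classical
  choose r hr using fun x : Set.range u => x.2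
  have hvr (i : ι) : v (r ⟨u i, i, rfl⟩) = v i := (h _ _).1 (hr ⟨u i, i, rfl⟩)
  let e : Set.range u ≃ Set.range v := Equiv.ofBijective (fun x => ⟨v (r x), r x, rfl⟩) <| by
    constructor
    · intro x y hxy
      exact Subtype.ext ((hr x).symm.trans
        (((h _ _).2 (congrArg Subtype.val hxy)).trans (hr y)))
    · rintro ⟨_, i, rfl⟩
      exact ⟨⟨u i, i, rfl⟩, Subtype.ext (hvr i)⟩
  refine ⟨Equiv.extendSubtype (p := (· ∈ Set.range u)) (q := (· ∈ Set.range v)) e, fun i => ?_⟩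
  rw [Equiv.extendSubtype_apply_of_mem _ _ ⟨i, rfl⟩]
  exact hvr i

/-! ### Finite hulls with vector-valued colors -/

section Hull

variable {W K : Type*} [DecidableEq W]

/-- The color of a set of points of `W × (Finset W → K → ZMod 2)`. -/
noncomputable def hullColor (T : Finset (W × (Finset W → K → ZMod 2))) : K → ZMod 2 :=
  open scoped Classical in
  if Set.InjOn Prod.fst (T : Set (W × (Finset W → K → ZMod 2))) then
    ∑ z ∈ T, z.2 (T.image Prod.fst) else 0

/-- The permutation of `W × (Finset W → K → ZMod 2)` induced by a permutation of `W`,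
a permutation of `K` and a translation. -/
def hullPerm (π : Equiv.Perm W) (χ : Equiv.Perm K) (b : W → Finset W → K → ZMod 2) :
    Equiv.Perm (W × (Finset W → K → ZMod 2)) where
  toFun z := (π z.1, fun s k => (z.2 + b z.1) (s.map π.symm.toEmbedding) (χ.symm k))
  invFun z := (π.symm z.1, (fun s k => z.2 (s.map π.toEmbedding) (χ k)) - b (π.symm z.1))
  left_inv z := by
    ext1
    · simp
    · ext s k
      simp [Finset.map_map]
  right_inv z := by
    ext1
    · simp
    · ext s k
      simp [Finset.map_map]

/-- On a set projecting injectively onto `s` the translation contributes `∑ w ∈ s, b w s = 0`, so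
only the permutation of coordinates remains. All other sets have color `0`, which that permutation
fixes. -/
theorem hullColor_map_hullPerm (π : Equiv.Perm W) (χ : Equiv.Perm K)
    {b : W → Finset W → K → ZMod 2} (hb : ∀ s, ∑ w ∈ s, b w s = 0)
    (T : Finset (W × (Finset W → K → ZMod 2))) :
    hullColor (T.map (hullPerm π χ b).toEmbedding) = hullColor T ∘ χ.symm := by
  have hinj : Set.InjOn Prod.fst (T.map (hullPerm π χ b).toEmbedding :
      Set (W × (Finset W → K → ZMod 2))) ↔
      Set.InjOn Prod.fst (T : Set (W × (Finset W → K → ZMod 2))) := by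
    rw [Finset.coe_map, Set.InjOn, Set.InjOn]
    constructor
    · intro h x hx y hy hxy
      exact (hullPerm π χ b).injective (h (Set.mem_image_of_mem _ hx) (Set.mem_image_of_mem _ hy)
        (congrArg π hxy))
    · rintro h _ ⟨x, hx, rfl⟩ _ ⟨y, hy, rfl⟩ hxy
      exact congrArg _ (h hx hy (π.injective hxy))
  unfold hullColor
  by_cases hT : Set.InjOn Prod.fst (T : Set (W × (Finset W → K → ZMod 2)))
  · rw [if_pos hT, if_pos (hinj.2 hT)]
    have himg : (T.map (hullPerm π χ b).toEmbedding).image Prod.fst =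
        (T.image Prod.fst).map π.toEmbedding := by
      ext x
      simp only [Finset.mem_image, Finset.mem_map]
      constructor
      · rintro ⟨_, ⟨z, hz, rfl⟩, rfl⟩
        exact ⟨z.1, ⟨z, hz, rfl⟩, rfl⟩
      · rintro ⟨_, ⟨z, hz, rfl⟩, rfl⟩
        exact ⟨_, ⟨z, hz, rfl⟩, rfl⟩
    rw [himg, Finset.sum_map]
    ext k
    have h0 := congrFun (hb (T.image Prod.fst)) (χ.symm k)
    rw [Finset.sum_image hT] at h0
    simp only [Finset.sum_apply, Pi.zero_apply] at h0
    simp [hullPerm, Finset.map_map, Finset.sum_add_distrib, h0]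
  · rw [if_neg hT, if_neg (hinj.not.2 hT)]
    rfl

variable [DecidableEq K]

/-- Colors of `W` become unit vectors, so that distinct colors stay distinct and a permutation of
colors acts additively, by permuting coordinates. -/
theorem hullColor_map {c : Finset W → K} {i : W → Finset W → K → ZMod 2}
    (hi : ∀ s : Finset W, s.Nonempty → ∑ w ∈ s, i w s = Pi.single (c s) 1) (j : W ↪ _)
    (hj : ∀ w, j w = (w, i w)) {s : Finset W} (hs : s.Nonempty) :
    hullColor (s.map j) = Pi.single (c s) 1 := by
  have himg : (s.map j).image Prod.fst = s := by
    ext x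
    simp [-Prod.exists, hj]
  rw [hullColor, if_pos, himg, Finset.sum_map]
  · simp only [hj, hi s hs]
  · rw [Finset.coe_map]
    rintro _ ⟨x, hx, rfl⟩ _ ⟨y, hy, rfl⟩ hxy
    simp only [hj] at hxy ⊢
    rw [hxy]

/-- The condition on `D` prescribes `b w s` for `w ∈ D`. If `s ⊆ D`, the prescribed values sum to
zero because `χ` matches the colors of `s` and of its image; otherwise a point of `s` outside `D` is
free to correct the sum. -/
theorem exists_hullPerm_apply_eq {c : Finset W → K} {i : W → Finset W → K → ZMod 2}
    (hi : ∀ s : Finset W, s.Nonempty → ∑ w ∈ s, i w s = Pi.single (c s) 1)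
    {π : Equiv.Perm W} {χ : Equiv.Perm K} {D : Set W}
    (h : ∀ s : Finset W, (s : Set W) ⊆ D → χ (c s) = c (s.map π.toEmbedding)) :
    ∃ b : W → Finset W → K → ZMod 2, (∀ s, ∑ w ∈ s, b w s = 0) ∧
      ∀ w ∈ D, hullPerm π χ b (w, i w) = (π w, i (π w)) := by
  -- The translation needed to carry `(w, i w)` to `(π w, i (π w))`.
  let e (w : W) (s : Finset W) : K → ZMod 2 := i (π w) (s.map π.toEmbedding) ∘ χ - i w s
  have key (s : Finset W) : ∃ b : W → K → ZMod 2, ∑ w ∈ s, b w = 0 ∧ ∀ w ∈ D, b w = e w s := by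
    by_cases hs : (s : Set W) ⊆ D
    · refine ⟨fun w => e w s, ?_, fun _ _ => rfl⟩
      rcases s.eq_empty_or_nonempty with rfl | hne
      · simp
      have h1 := hi (s.map π.toEmbedding) (hne.map)
      rw [Finset.sum_map, ← h s hs] at h1
      simp only [e]
      rw [Finset.sum_sub_distrib, hi s hne]
      ext k
      have := congrFun h1 (χ k)
      simp only [Finset.sum_apply, Equiv.coe_toEmbedding] at this
      simp only [Pi.sub_apply, Finset.sum_apply, Function.comp_apply, this, Pi.zero_apply]
      simp [Pi.single_apply]
    · obtain ⟨w₀, hw₀, hw₀D⟩ := Set.not_subset.1 hs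
      refine ⟨Function.update (fun w => e w s) w₀ (-∑ w ∈ s.erase w₀, e w s), ?_, ?_⟩
      · rw [← Finset.add_sum_erase s _ hw₀, Function.update_self]
        rw [Finset.sum_congr rfl fun w hw => Function.update_of_ne (Finset.ne_of_mem_erase hw) _ _]
        simp
      · intro w hw
        exact Function.update_of_ne (fun h : w = w₀ => hw₀D (h ▸ hw)) _ _
  choose b hb hb' using key
  refine ⟨fun w s => b s w, hb, fun w hw => ?_⟩
  ext1
  · rfl
  · ext s k
    change i w (s.map π.symm.toEmbedding) (χ.symm k) + b (s.map π.symm.toEmbedding) w (χ.symm k) = _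
    rw [hb' _ w hw]
    simp [e, Finset.map_map]

end Hull

theorem hrushovskiProperty {S : Set ℕ} {M : Type u} [(eqLang S).Structure M] [Countable M]
    (hM : IsFraisseLimit (eqClass.{u} S) M) : HrushovskiProperty (eqLang S) M := by
  classical
  intro P hP hdom
  obtain ⟨c, hc⟩ := exists_isColoring_of_age_subset hM.age.le
  have hcod (p) (hp : p ∈ P) : (p.cod : Set M).Finite := by
    have : Finite p.dom := hdom p hp
    exact Finite.of_equiv _ p.toEquiv.toEquiv
  let W : (eqLang S).Substructure M := ofSet (⋃ p ∈ P, ((p.dom : Set M) ∪ p.cod))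
  have : Finite W := hP.biUnion fun p hp => (hdom p hp).union (hcod p hp)
  have hdomW (p) (hp : p ∈ P) : p.dom ≤ W := fun x hx =>
    Set.mem_biUnion hp (Or.inl hx)
  have hcodW (p) (hp : p ∈ P) : p.cod ≤ W := fun x hx =>
    Set.mem_biUnion hp (Or.inr hx)
  have := Fintype.ofFinite W
  have hcW := hc.comap W.subtype
  let K := Set.range fun s : Finset W => c (s.map W.subtype.toEmbedding)
  have : Finite K := Set.finite_range _
  have := Fintype.ofFinite K
  let cW (s : Finset W) : K := ⟨c (s.map W.subtype.toEmbedding), s, rfl⟩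
  have hcWK {s t : Finset W} : cW s = cW t ↔
    c (s.map W.subtype.toEmbedding) = c (t.map W.subtype.toEmbedding) := Subtype.ext_iff
  have hi : ∀ s : Finset W, ∃ i : W → K → ZMod 2, s.Nonempty → ∑ w ∈ s, i w = Pi.single (cW s) 1 := by
    intro s
    rcases s.eq_empty_or_nonempty with rfl | ⟨w, hw⟩
    · exact ⟨0, fun h => absurd h Finset.not_nonempty_empty⟩
    · refine ⟨Pi.single w (Pi.single (cW s) 1), fun _ => ?_⟩
      rw [Finset.sum_pi_single', if_pos hw]
  choose i hi using hi
  let sH : (eqLang S).Structure (W × (Finset W → K → ZMod 2)) := colorStructure S hullColor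
  have hH : IsColoring S (normalizeColor S (hullColor : Finset (W × (Finset W → K → ZMod 2)) → _)) :=
    isColoring_colorStructure S hullColor
  let j₀ : W ↪ W × (Finset W → K → ZMod 2) :=
    ⟨fun w => (w, fun s => i s w), fun x y h => congrArg Prod.fst h⟩
  let j : W ↪[eqLang S] W × (Finset W → K → ZMod 2) := hcW.embedding hH j₀ fun s t => by
    rw [normalizeColor_eq_iff, Finset.card_map, Finset.card_map]
    by_cases hst : s.card = t.card
    swap
    · exact iff_of_false (fun h => hst (hcW.card_eq h)) fun h => hst h.1
    by_cases hs : s.card ∈ S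
    swap
    · exact iff_of_true (hcW.eq_of_notMem hst hs) ⟨hst, fun h => absurd h hs⟩
    rcases s.eq_empty_or_nonempty with rfl | hne
    · obtain rfl : t = ∅ := Finset.card_eq_zero.1 hst.symm
      simp
    have hne' : t.Nonempty := Finset.card_pos.1 (hst ▸ Finset.card_pos.2 hne)
    rw [hullColor_map (i := fun w s => i s w) hi j₀ (fun _ => rfl) hne,
      hullColor_map (i := fun w s => i s w) hi j₀ (fun _ => rfl) hne', ← hcWK]
    constructor
    · intro h
      exact ⟨hst, fun _ => by rw [h]⟩
    · rintro ⟨-, h⟩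
      have := congrFun (h hs) (cW s)
      rw [Pi.single_eq_same, Pi.single_apply] at this
      by_contra hne
      rw [if_neg hne] at this
      exact one_ne_zero this
  have hHM : Nonempty (W × (Finset W → K → ZMod 2) ↪[eqLang S] M) := by
    have : (⟨W × (Finset W → K → ZMod 2), sH⟩ : CategoryTheory.Bundled (eqLang S).Structure) ∈
        (eqLang S).age M := by
      rw [hM.age]
      exact mem_eqClass_of_isColoring hH
    exact this.2
  -- Ultrahomogeneity places the hull in `M` so that the copy of `W` in it is `W` itself.
  obtain ⟨f, hf⟩ := hM.ultrahomogeneous.extend_embedding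
    (Structure.fg_iff_finite.2 ‹Finite W›) W.subtype j
  have hfj (w : W) : f (j w) = w := (DFunLike.congr_fun hf w).symm
  have hWF : W ≤ f.toHom.range := fun x hx => Hom.mem_range.2 ⟨j ⟨x, hx⟩, hfj ⟨x, hx⟩⟩
  refine ⟨f.toHom.range, ?_, fun p hp => ⟨(hdomW p hp).trans hWF, (hcodW p hp).trans hWF, ?_⟩⟩
  · rw [Hom.range_coe]
    exact Set.finite_range _
  let u : p.dom ↪[eqLang S] W := Substructure.inclusion (hdomW p hp)
  let v : p.dom ↪[eqLang S] W := (Substructure.inclusion (hcodW p hp)).comp p.toEquiv.toEmbedding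
  obtain ⟨π, hπ⟩ := exists_perm_apply_eq (u := u) (v := v) fun x y => by
    rw [u.injective.eq_iff, v.injective.eq_iff]
  -- As `p` is an isomorphism, it induces a partial injection on colors, which extends to a
  -- permutation of `K`.
  obtain ⟨χ, hχ⟩ := exists_perm_apply_eq (u := fun s : Finset p.dom => cW (s.map u.toEmbedding))
    (v := fun s : Finset p.dom => cW (s.map v.toEmbedding)) fun s t => by
      rw [hcWK, hcWK, ← (hcW.comap u).eq_iff hcW v]
  obtain ⟨b, hb, hbD⟩ := exists_hullPerm_apply_eq (c := cW) (i := fun w s => i s w) hi (π := π)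
    (χ := χ) (D := Set.range u) fun s hs => by
      obtain ⟨t, rfl⟩ : ∃ t : Finset p.dom, t.map u.toEmbedding = s := by
        refine ⟨s.preimage u u.injective.injOn, ?_⟩
        ext x
        simp only [Finset.mem_map, Finset.mem_preimage]
        exact ⟨fun ⟨a, ha, h⟩ => h ▸ ha, fun hx => by
          obtain ⟨a, rfl⟩ := hs hx
          exact ⟨a, hx, rfl⟩⟩
      rw [hχ, Finset.map_map]
      congr 2
      ext x
      exact congrArg Subtype.val (hπ x).symm
  let hP : W × (Finset W → K → ZMod 2) ↪[eqLang S] W × (Finset W → K → ZMod 2) :=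
    hH.embedding hH (hullPerm π χ b).toEmbedding fun s t => by
      rw [normalizeColor_eq_iff, normalizeColor_eq_iff, hullColor_map_hullPerm π χ hb,
        hullColor_map_hullPerm π χ hb, χ.symm.surjective.injective_comp_right.eq_iff,
        Finset.card_map, Finset.card_map]
  let g₀ : W × (Finset W → K → ZMod 2) ≃[eqLang S] W × (Finset W → K → ZMod 2) :=
    { hP with
      toEquiv := hullPerm π χ b
      map_fun' := hP.map_fun'
      map_rel' := hP.map_rel' }
  refine ⟨f.equivRange.comp (g₀.comp f.equivRange.symm), fun x hx hxF => ?_⟩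
  have h1 : (⟨x, hxF⟩ : f.toHom.range) = f.equivRange (j (u ⟨x, hx⟩)) :=
    Subtype.ext (hfj (u ⟨x, hx⟩)).symm
  have h2 : g₀ (j (u ⟨x, hx⟩)) = j (v ⟨x, hx⟩) := by
    rw [← hπ]
    exact hbD _ ⟨_, rfl⟩
  rw [h1]
  rw [Language.Equiv.comp_apply, Language.Equiv.comp_apply, Language.Equiv.symm_apply_apply, h2,
    Embedding.equivRange_apply, hfj]
  rfl

/-! ### Amenability -/

section Amenability

open MeasureTheory Filter Topology BoundedContinuousFunction

variable {L : Language} {M : Type u} [L.Structure M]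

/-- By compactness of `X` the estimate is uniform in `y` for `τ` near `1`, and a neighborhood of `1`
contains the pointwise stabilizer of a finite set. -/
theorem exists_finset_forall_fixing_abs_sub_le {X : Type v} [TopologicalSpace X] [CompactSpace X]
    [MulAction (Aut L M) X] [ContinuousSMul (Aut L M) X] (f : X →ᵇ ℝ) {ε : ℝ} (hε : 0 < ε) :
    ∃ A : Finset M, ∀ τ : Aut L M, (∀ a ∈ A, (τ : Equiv.Perm M) a = a) →
      ∀ y : X, |f (τ • y) - f y| ≤ ε := by
  let U : Set (Aut L M × X) := {z | |f (z.1 • z.2) - f z.2| < ε}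
  have hU : IsOpen U := isOpen_lt (by fun_prop) continuous_const
  obtain ⟨V, _, hV, -, h1, h2, hVU⟩ := generalized_tube_lemma (isCompact_singleton (x := (1 : Aut L M)))
    (isCompact_univ (X := X)) hU (by rintro ⟨g, y⟩ ⟨rfl, -⟩; simpa [U] using hε)
  let : TopologicalSpace M := ⊥
  obtain ⟨V', hV', rfl⟩ := isOpen_induced_iff.1 hV
  obtain ⟨A, u, hu, hA⟩ := isOpen_pi_iff.1 hV' _ (h1 rfl)
  refine ⟨A, fun τ hτ y => (hVU (a := (τ, y)) ⟨hA fun a ha => ?_, h2 trivial⟩ : _ < _).le⟩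
  change (τ : Equiv.Perm M) a ∈ u a
  rw [hτ a ha]
  exact (hu a ha).2

variable [L.IsRelational]

/-- The measure is the uniform average of point masses at `k q • x₀`, where `q` runs over the
automorphisms of a finite `F` to which the restrictions of all `g ∈ P` to `g⁻¹ A` extend.
Translation by `g` permutes these points up to elements fixing `A` pointwise. -/
theorem exists_average (hU : L.IsUltrahomogeneous M) (hH : HrushovskiProperty L M)
    {X : Type v} [TopologicalSpace X] [T2Space X] [Nonempty X]
    [MeasurableSpace X] [BorelSpace X] [MulAction (Aut L M) X]
    (A : Finset M) (P : Finset (Aut L M)) :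
    ∃ μ : ProbabilityMeasure X, ∀ (f : X →ᵇ ℝ) (ε : ℝ),
      (∀ τ : Aut L M, (∀ a ∈ A, (τ : Equiv.Perm M) a = a) → ∀ y : X, |f (τ • y) - f y| ≤ ε) →
      ∀ g ∈ P, |∫ x, f (g • x) ∂(μ : Measure X) - ∫ x, f x ∂(μ : Measure X)| ≤ ε := by
  classical
  have hlift (g : Aut L M) : ∃ g' : M ≃[L] M, ∀ x, g' x = (g : Equiv.Perm M) x := by
    obtain ⟨g', hg'⟩ := g.2
    exact ⟨g', fun x => congrArg (· x) hg'⟩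
  choose e he using hlift
  let D (g : Aut L M) : L.Substructure M := ofSet {x | (g : Equiv.Perm M) x ∈ A}
  have hD (g : Aut L M) : (D g : Set M).Finite :=
    Set.Finite.preimage (f := (g : Equiv.Perm M)) (g : Equiv.Perm M).injective.injOn A.finite_toSet
  let p (g : Aut L M) : M ≃ₚ[L] M :=
    ⟨D g, _, ((e g).toEmbedding.comp (D g).subtype).equivRange⟩
  obtain ⟨F, hF, hpF⟩ := hH (p '' P) (P.finite_toSet.image p) (by rintro _ ⟨g, -, rfl⟩; exact hD g)
  have : Finite F := hF
  have : Finite (F ≃[L] F) := Finite.of_injective _ (DFunLike.coe_injective (F := F ≃[L] F))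
  have := Fintype.ofFinite (F ≃[L] F)
  have : Nonempty (F ≃[L] F) := ⟨Language.Equiv.refl L F⟩
  -- The lifts `k q` are arbitrary choices and need not form a group.
  have hk (q : F ≃[L] F) : ∃ k : Aut L M, ∀ x : F, (k : Equiv.Perm M) x = q x := by
    obtain ⟨k, hk⟩ := hU F (Substructure.fg_iff_finite.2 ‹Finite F›) (F.subtype.comp q.toEmbedding)
    exact ⟨⟨k.toEquiv, k, rfl⟩, fun x => (DFunLike.congr_fun hk x).symm⟩
  choose k hk using hk
  obtain ⟨x₀⟩ := ‹Nonempty X›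
  let N := Fintype.card (F ≃[L] F)
  have hN : N ≠ 0 := Fintype.card_ne_zero
  let μ : Measure X := ∑ q : F ≃[L] F, (N : ENNReal)⁻¹ • Measure.dirac (k q • x₀)
  have hμ : IsProbabilityMeasure μ := ⟨by
    simp only [μ, Measure.coe_finsetSum, Finset.sum_apply, Measure.smul_apply, measure_univ,
      Finset.sum_const, smul_eq_mul, mul_one, nsmul_eq_mul]
    exact ENNReal.mul_inv_cancel (by exact_mod_cast hN) (by simp)⟩
  have hint (f : X → ℝ) : ∫ x, f x ∂μ = (N : ℝ)⁻¹ * ∑ q : F ≃[L] F, f (k q • x₀) := by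
    rw [integral_finsetSum_measure fun q _ =>
      (integrable_dirac (by simp)).smul_measure (by simpa using hN), Finset.mul_sum]
    refine Finset.sum_congr rfl fun q _ => ?_
    rw [integral_smul_measure, integral_dirac]
    simp
  refine ⟨⟨μ, hμ⟩, fun f ε hf g hg => ?_⟩
  obtain ⟨hDF, -, h, hh⟩ := hpF _ ⟨g, hg, rfl⟩
  have hbij : Function.Bijective fun q : F ≃[L] F => h.comp q := by
    refine Finite.injective_iff_bijective.1 fun q q' hq => ?_
    ext x
    have := congrArg (fun q : F ≃[L] F => h.symm (q x)) hq
    simpa using this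
  change |∫ x, f (g • x) ∂μ - ∫ x, f x ∂μ| ≤ ε
  rw [hint, hint, ← hbij.sum_comp fun q => f (k q • x₀), ← mul_sub, ← Finset.sum_sub_distrib, abs_mul,
    abs_of_nonneg (by positivity), inv_mul_le_iff₀ (by positivity)]
  refine (Finset.abs_sum_le_sum_abs _ _).trans ((Finset.sum_le_card_nsmul _ _ ε fun q _ => ?_).trans
    (by simp [N]))
  -- With `h` extending `g` on `g⁻¹ A`, both `g * k q` and `k (h.comp q)` send `q⁻¹ (g⁻¹ a)` to `a`,
  -- so their quotient fixes `A` pointwise.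
  have key := hf (g * k q * (k (h.comp q))⁻¹) (fun a ha => ?_) (k (h.comp q) • x₀)
  · rwa [smul_smul, inv_mul_cancel_right, mul_smul] at key
  let b : M := (g : Equiv.Perm M).symm a
  have hgb : (g : Equiv.Perm M) b = a := (g : Equiv.Perm M).apply_symm_apply a
  have hbD : b ∈ D g := by
    change (g : Equiv.Perm M) b ∈ A
    rwa [hgb]
  let x : F := q.symm ⟨b, hDF hbD⟩
  have hqx : q x = ⟨b, hDF hbD⟩ := q.apply_symm_apply _
  have hkx : (k (h.comp q) : Equiv.Perm M) x = a := by
    rw [hk, Language.Equiv.comp_apply, hqx]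
    exact (hh b hbD _).trans ((he g b).trans hgb)
  have hkx' : (k (h.comp q) : Equiv.Perm M).symm a = x := by rw [← hkx, Equiv.symm_apply_apply]
  change (g : Equiv.Perm M) ((k q : Equiv.Perm M) ((k (h.comp q) : Equiv.Perm M).symm a)) = a
  rw [hkx', hk, hqx, hgb]

/-- The space of probability measures on `X` is compact, so the averages converge along an
ultrafilter finer than `atTop`. The error bound `ε` is eventually valid for each `g`, `f` and `ε >
0`. -/
theorem amenable_aut (hU : L.IsUltrahomogeneous M) (hH : HrushovskiProperty L M) :
    Amenable.{u, v} (Aut L M) := by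
  classical
  intro X _ _ _ _ _ _ _ _
  choose μ hμ using exists_average (X := X) hU hH
  let U : Ultrafilter (Finset M × Finset (Aut L M)) := Ultrafilter.of atTop
  obtain ⟨μ', hμ'⟩ : ∃ μ', Tendsto (fun i : Finset M × Finset (Aut L M) => μ i.1 i.2) U (𝓝 μ') :=
    ⟨_, (U.map fun i : Finset M × Finset (Aut L M) => μ i.1 i.2).le_nhds_lim⟩
  rw [ProbabilityMeasure.tendsto_iff_forall_integral_tendsto] at hμ'
  have hinv (g : Aut L M) (f : X →ᵇ ℝ) :
      ∫ x, f (g • x) ∂(μ' : Measure X) = ∫ x, f x ∂(μ' : Measure X) := by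
    let fg : X →ᵇ ℝ := f.compContinuous ⟨fun x => g • x, continuous_const_smul g⟩
    have hlim := ((hμ' fg).sub (hμ' f)).abs
    rw [← sub_eq_zero, ← abs_nonpos_iff]
    refine le_of_forall_pos_le_add fun ε hε => ?_
    rw [zero_add]
    obtain ⟨A, hA⟩ := exists_finset_forall_fixing_abs_sub_le (L := L) (M := M) f hε
    refine le_of_tendsto hlim (Ultrafilter.of_le atTop ?_)
    filter_upwards [mem_atTop (A, {g})] with i hi
    exact hμ i.1 i.2 f ε (fun τ hτ => hA τ fun a ha => hτ a (hi.1 ha)) g (hi.2 (by simp))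
  -- Since `X` need not be metrizable, integrals of continuous functions determine a measure only
  -- among regular ones; hence the passage to a regular `ν` with the same integrals.
  obtain ⟨ν, hν, hνf, hνμ⟩ := Measure.exists_regular_eq_of_compactSpace (μ' : Measure X)
  have hmap (g : Aut L M) : ν.map (g • ·) = ν := by
    have : (ν.map (g • ·)).Regular := Measure.Regular.map (Homeomorph.smul g)
    refine Measure.ext_of_integral_eq_on_compactlySupported fun f => ?_
    refine (integral_map (measurable_const_smul g).aemeasurable
      f.continuous.measurable.aestronglyMeasurable).trans ?_
    let f' : X →ᵇ ℝ := BoundedContinuousFunction.mkOfCompact ⟨f, f.continuous⟩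
    have h1 := hνμ (f'.compContinuous ⟨fun x => g • x, continuous_const_smul g⟩)
    exact h1.symm.trans ((hinv g f').trans (hνμ f'))
  refine ⟨ν, ⟨?_⟩, ⟨fun g s hs => ?_⟩⟩
  · have h := hνμ 1
    simp only [BoundedContinuousFunction.coe_one, Pi.one_apply, integral_const, smul_eq_mul, mul_one,
      probReal_univ] at h
    rw [Measure.real, eq_comm, ENNReal.toReal_eq_one_iff] at h
    exact h
  · conv_rhs => rw [← hmap g]
    rw [Measure.map_apply (measurable_const_smul g) hs]

end Amenability

/-! ### Expansions by linear orders -/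

/-- The structure induced on the domain of a function into a relational structure. -/
@[reducible] def inducedAlong {L : Language} [L.IsRelational] {C M : Type*} [L.Structure M]
    (f : C → M) : L.Structure C where
  funMap g := isEmptyElim g
  RelMap r z := Structure.RelMap r (f ∘ z)

/-- The edges of the pentagon. -/
def pentagon (s : Finset (ZMod 5)) : Bool := decide (s.card = 2 ∧ ∃ x, x ∈ s ∧ x + 1 ∈ s)

/-- Non-neighbors `v ± 2` of `v` form an edge and neighbors `v ± 1` a diagonal; the pairs containing
`v` behave oppositely. -/
theorem pentagon_image (v a b : ZMod 5) (ha : a = 2 ∨ a = 3) (hb : b = 1 ∨ b = 4)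
    (s : Finset (Fin 3)) (hs : s.card = 2) :
    pentagon (s.image ![v + b, v - b, v]) = !pentagon (s.image ![v + a, v - a, v]) := by
  revert v a b s
  decide

theorem pentagon_eq_false {s : Finset (ZMod 5)} (hs : s.card ≠ 2) : pentagon s = false := by
  simp [pentagon, hs]

theorem pentagon_edge (v a : ZMod 5) (ha : a = 2 ∨ a = 3) :
    pentagon {v + a, v - a} = true ∧ pentagon {v + a, v} = false := by
  revert v a
  decide

theorem pentagon_diagonal (v b : ZMod 5) (hb : b = 1 ∨ b = 4) :
    pentagon {v + b, v - b} = false ∧ pentagon {v + b, v} = true := by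
  revert v b
  decide

/-- Take `v` to be the greatest vertex; the signs of `a = ±2` and `b = ±1` are chosen so that `v +
a` and `v + b` are the lesser ones. -/
theorem exists_strictMono_pentagon {α : Type*} [LinearOrder α] (e : ZMod 5 ↪ α) :
    ∃ v a b : ZMod 5, (a = 2 ∨ a = 3) ∧ (b = 1 ∨ b = 4) ∧
      StrictMono (fun i => e (![v + a, v - a, v] i)) ∧
      StrictMono (fun i => e (![v + b, v - b, v] i)) := by
  obtain ⟨v, hv⟩ := Finite.exists_max e
  have key (a : ZMod 5) (ha : v - a ≠ v) (h : e (v + a) < e (v - a)) :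
      StrictMono (fun i => e (![v + a, v - a, v] i)) := by
    have h' : e (v - a) < e v := (hv _).lt_of_ne fun h => ha (e.injective h)
    rw [Fin.strictMono_iff_lt_succ]
    intro i
    fin_cases i
    exacts [h, h']
  have choice (a a' : ZMod 5) (haa : a' = -a) (h1 : v - a ≠ v) (h2 : v - a' ≠ v) (h3 : v + a ≠ v - a) :
      ∃ b, (b = a ∨ b = a') ∧ StrictMono (fun i => e (![v + b, v - b, v] i)) := by
    rcases lt_or_gt_of_ne fun h => h3 (e.injective h) with h | h
    · exact ⟨a, Or.inl rfl, key a h1 h⟩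
    · refine ⟨a', Or.inr rfl, key a' h2 ?_⟩
      rwa [haa, sub_neg_eq_add, ← sub_eq_add_neg]
  have hne : ∀ v c : ZMod 5, c ≠ 0 → v - c ≠ v ∧ v + c ≠ v - c := by decide
  obtain ⟨a, ha, ha'⟩ := choice 2 3 (by decide) (hne v 2 (by decide)).1 (hne v 3 (by decide)).1
    (hne v 2 (by decide)).2
  obtain ⟨b, hb, hb'⟩ := choice 1 4 (by decide) (hne v 1 (by decide)).1 (hne v 4 (by decide)).1
    (hne v 1 (by decide)).2
  exact ⟨v, a, b, ha, hb, ha', hb'⟩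

theorem not_ramseyProperty_age_orderExpansion {S : Set ℕ} (h2 : 2 ∈ S) {M : Type u}
    [(eqLang S).Structure M] [Countable M] (hM : IsFraisseLimit (eqClass.{u} S) M)
    (o : LinearOrder M) :
    letI : ((eqLang S).sum Language.order).Structure M := orderExpansion (eqLang S) M o
    ¬ RamseyProperty (((eqLang S).sum Language.order).age M) := by
  classical
  let sM : ((eqLang S).sum Language.order).Structure M := orderExpansion (eqLang S) M o
  intro hR
  obtain ⟨c, hc⟩ : ∃ c : Finset M → ℕ, IsColoring S c :=
    (exists_isColoring_of_age_subset hM.age.le).choose_spec.exists_nat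
  -- the pentagon, as a colored structure
  let p (s : Finset (ULift.{u} (ZMod 5))) : Bool := pentagon (s.map Equiv.ulift.toEmbedding)
  let sT : (eqLang S).Structure (ULift.{u} (ZMod 5)) := colorStructure S p
  have hp : IsColoring S (normalizeColor S p) := isColoring_colorStructure S p
  obtain ⟨e⟩ : Nonempty (ULift.{u} (ZMod 5) ↪[eqLang S] M) := by
    have : (⟨ULift.{u} (ZMod 5), sT⟩ : CategoryTheory.Bundled (eqLang S).Structure) ∈
        (eqLang S).age M := by
      rw [hM.age]
      exact mem_eqClass_of_isColoring hp
    exact this.2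
  obtain ⟨v, a, b, ha, hb, hxm, hym⟩ := exists_strictMono_pentagon
    (Equiv.ulift.{u}.symm.toEmbedding.trans e.toEmbedding)
  let x (i : Fin 3) : ULift.{u} (ZMod 5) := ⟨![v + a, v - a, v] i⟩
  let y (i : Fin 3) : ULift.{u} (ZMod 5) := ⟨![v + b, v - b, v] i⟩
  replace hxm : StrictMono fun i => e (x i) := hxm
  replace hym : StrictMono fun i => e (y i) := hym
  -- the two triples span isomorphic structures
  have hxy {n : ℕ} (r : (eqLang S).Relations n) (z : Fin n → Fin 3) :
      Structure.RelMap r (x ∘ z) ↔ Structure.RelMap r (y ∘ z) := by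
    let ex : Fin 3 ↪ ULift.{u} (ZMod 5) := ⟨x, fun i j h => hxm.injective (congrArg e h)⟩
    let ey : Fin 3 ↪ ULift.{u} (ZMod 5) := ⟨y, fun i j h => hym.injective (congrArg e h)⟩
    let s3 : (eqLang S).Structure (Fin 3) := colorStructure S fun s : Finset (Fin 3) => p (s.map ex)
    have h3 := isColoring_colorStructure S fun s : Finset (Fin 3) => p (s.map ex)
    have hpe (s : Finset (Fin 3)) (hs : s.card = 2) : p (s.map ey) = !p (s.map ex) := by
      have := pentagon_image v a b ha hb s hs
      simp only [p, Finset.map_eq_image, Finset.image_image]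
      exact this
    let fx : Fin 3 ↪[eqLang S] ULift.{u} (ZMod 5) := h3.embedding hp ex fun s t => by
      simp only [normalizeColor_eq_iff, Finset.card_map]
    let fy : Fin 3 ↪[eqLang S] ULift.{u} (ZMod 5) := h3.embedding hp ey fun s t => by
      simp only [normalizeColor_eq_iff, Finset.card_map]
      refine and_congr_right fun hst => imp_congr_right fun _ => ?_
      by_cases hs : s.card = 2
      · rw [hpe s hs, hpe t (hst ▸ hs)]
        simp
      · have h0 (f : Fin 3 ↪ ULift.{u} (ZMod 5)) (s : Finset (Fin 3)) (hs : s.card ≠ 2) :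
            p (s.map f) = false := pentagon_eq_false (by simpa using hs)
        rw [h0 ex s hs, h0 ex t (hst ▸ hs), h0 ey s hs, h0 ey t (hst ▸ hs)]
    exact (fx.map_rel r z).trans (fy.map_rel r z).symm
  let L' := (eqLang S).sum Language.order
  let sB : L'.Structure (ULift.{u} (ZMod 5)) := inducedAlong e
  let A : Type u := ULift.{u} (Fin 3)
  let sA : L'.Structure A := inducedAlong fun i : A => x i.down
  let eB : ULift.{u} (ZMod 5) ↪[L'] M := ⟨e.toEmbedding, fun g => isEmptyElim g, fun _ _ => Iff.rfl⟩
  let fx : A ↪[L'] ULift.{u} (ZMod 5) :=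
    ⟨⟨fun i => x i.down, fun i j h => ULift.ext _ _ (hxm.injective (congrArg e h))⟩,
      fun g => isEmptyElim g, fun _ _ => Iff.rfl⟩
  let fy : A ↪[L'] ULift.{u} (ZMod 5) :=
    ⟨⟨fun i => y i.down, fun i j h => ULift.ext _ _ (hym.injective (congrArg e h))⟩,
      fun g => isEmptyElim g, by
        rintro n (r | r) z
        · exact (e.map_rel r _).trans ((hxy r (ULift.down ∘ z)).symm.trans (e.map_rel r _).symm)
        · cases r
          exact hym.le_iff_le.trans hxm.le_iff_le.symm⟩
  have hB : (⟨ULift.{u} (ZMod 5), sB⟩ : CategoryTheory.Bundled L'.Structure) ∈ L'.age M :=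
    ⟨Structure.fg_iff_finite.2 inferInstance, ⟨eB⟩⟩
  have hA : (⟨A, sA⟩ : CategoryTheory.Bundled L'.Structure) ∈ L'.age M :=
    ⟨Structure.fg_iff_finite.2 inferInstance, ⟨eB.comp fx⟩⟩
  obtain ⟨C, ⟨-, ⟨ι⟩⟩, hC⟩ := hR 2 _ hA _ hB ⟨fx⟩
  -- The numerical colors `c` order the `E_2`-classes. A triple is colored by comparing its lower
  -- pair with the pair of its least and greatest points.
  let Q (s : Set C) : Prop := ∃ w : Fin 3 → C, StrictMono (fun i => ι (w i)) ∧ Set.range w = s ∧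
    c {ι (w 0), ι (w 1)} < c {ι (w 0), ι (w 2)}
  obtain ⟨B', ⟨β⟩, col, hcol⟩ := hC fun s => if Q (s : L'.Substructure C) then 0 else 1
  let j : ULift.{u} (ZMod 5) ↪[L'] C := B'.subtype.comp β.toEmbedding
  let h : ULift.{u} (ZMod 5) ↪[L'] M := ι.comp j
  have hQ (f : A ↪[L'] ULift.{u} (ZMod 5)) (hf : StrictMono fun i : Fin 3 => e (f ⟨i⟩)) :
      (if c {h (f ⟨0⟩), h (f ⟨1⟩)} < c {h (f ⟨0⟩), h (f ⟨2⟩)} then (0 : Fin 2) else 1) = col := by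
    rw [← hcol ⟨(j.comp f).toHom.range, ⟨(j.comp f).equivRange⟩⟩ ?_]
    · congr 1
      have hmono : StrictMono fun i : Fin 3 => h (f ⟨i⟩) := by
        refine strictMono_of_le_iff_le fun i k => ?_
        have h1 := h.map_rel (Sum.inr (leSymb : Language.order.Relations 2) : L'.Relations 2) ![f ⟨i⟩, f ⟨k⟩]
        exact hf.le_iff_le.symm.trans h1.symm
      have hrange : Set.range (fun i : Fin 3 => j (f ⟨i⟩)) = ((j.comp f).toHom.range : Set C) := by
        ext z
        constructor
        · rintro ⟨i, rfl⟩
          exact ⟨⟨i⟩, rfl⟩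
        · rintro ⟨i, rfl⟩
          exact ⟨i.down, rfl⟩
      refine propext ⟨fun hlt => ⟨_, hmono, hrange, hlt⟩, ?_⟩
      rintro ⟨w, hw, hwr, hlt⟩
      -- A finite set has only one increasing enumeration, so `Q` does not depend on `w`.
      have : (fun i => ι (w i)) = fun i : Fin 3 => h (f ⟨i⟩) := by
        rw [← hw.range_inj hmono]
        change Set.range (ι ∘ w) = Set.range (ι ∘ fun i : Fin 3 => j (f ⟨i⟩))
        rw [Set.range_comp, Set.range_comp, hwr, hrange]
      have h' (i) : ι (w i) = h (f ⟨i⟩) := congrFun this i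
      rwa [h', h', h'] at hlt
    · rintro _ ⟨i, rfl⟩
      exact (β (f i)).2
  let hL : ULift.{u} (ZMod 5) ↪[eqLang S] M := ⟨h.toEmbedding, fun g => isEmptyElim g, fun r z =>
    (h.map_rel (Sum.inl r : L'.Relations _) z).trans (e.map_rel r z)⟩
  have hcp {k l m n : ULift.{u} (ZMod 5)} (hkl : k ≠ l) (hmn : m ≠ n) :
      c {h k, h l} = c {h m, h n} ↔ pentagon {k.down, l.down} = pentagon {m.down, n.down} := by
    have := hp.eq_iff hc hL {k, l} {m, n}
    rw [normalizeColor_eq_iff, Finset.card_pair hkl, Finset.card_pair hmn] at this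
    simp only [Finset.map_insert, Finset.map_singleton, h2, true_and, true_imp_iff, p] at this
    exact this.symm
  have hx (i k : Fin 3) (hik : i ≠ k) : x i ≠ x k := fun h => hik (hxm.injective (congrArg e h))
  have hy (i k : Fin 3) (hik : i ≠ k) : y i ≠ y k := fun h => hik (hym.injective (congrArg e h))
  have e1 : c {h (x 0), h (x 1)} = c {h (y 0), h (y 2)} :=
    (hcp (hx 0 1 (by decide)) (hy 0 2 (by decide))).2
      ((pentagon_edge v a ha).1.trans (pentagon_diagonal v b hb).2.symm)
  have e2 : c {h (x 0), h (x 2)} = c {h (y 0), h (y 1)} :=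
    (hcp (hx 0 2 (by decide)) (hy 0 1 (by decide))).2
      ((pentagon_edge v a ha).2.trans (pentagon_diagonal v b hb).1.symm)
  have e3 : c {h (x 0), h (x 1)} ≠ c {h (x 0), h (x 2)} := fun h' => by
    have := (hcp (hx 0 1 (by decide)) (hx 0 2 (by decide))).1 h'
    have h'' := (pentagon_edge v a ha).1.symm.trans (this.trans (pentagon_edge v a ha).2)
    exact Bool.noConfusion h''
  have q1 := hQ fx hxm
  have q2 := hQ fy hym
  change (if c {h (x 0), h (x 1)} < c {h (x 0), h (x 2)} then (0 : Fin 2) else 1) = col at q1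
  change (if c {h (y 0), h (y 1)} < c {h (y 0), h (y 2)} then (0 : Fin 2) else 1) = col at q2
  -- The comparison for `y` is that for `x` with its sides exchanged, and by `e3` the sides differ,
  -- so the two copies have different colors.
  rw [← e1, ← e2, ← q1] at q2
  rcases lt_or_gt_of_ne e3 with hlt | hlt
  · rw [if_pos hlt, if_neg hlt.not_gt] at q2
    exact absurd q2 (by decide)
  · rw [if_pos hlt, if_neg hlt.not_gt] at q2
    exact absurd q2 (by decide)

end EqSubsets

theorem theorem1 :
    (∃ (M : Type u) (_ : EqSubsets.L₀.Structure M) (_ : Countable M),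
      Language.IsFraisseLimit EqSubsets.K₀.{u} M) ∧
    ∀ (M : Type u) [EqSubsets.L₀.Structure M] [Countable M],
      Language.IsFraisseLimit EqSubsets.K₀.{u} M →
        (EqSubsets.HrushovskiProperty EqSubsets.L₀ M ∧
          EqSubsets.Amenable.{u, v} (EqSubsets.Aut EqSubsets.L₀ M)) ∧
        ¬ EqSubsets.HasRamseyOrderExpansion EqSubsets.L₀ M ∧
        (letI : EqSubsets.L₁₂.Structure M := EqSubsets.incl.reduct M
         EqSubsets.Amenable.{u, v} (EqSubsets.Aut EqSubsets.L₁₂ M) ∧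
          ¬ EqSubsets.HasRamseyOrderExpansion EqSubsets.L₁₂ M) := by
  refine ⟨EqSubsets.exists_isFraisseLimit _, fun M _ _ hM => ?_⟩
  have hM' := EqSubsets.isFraisseLimit_reduct hM
  refine ⟨⟨EqSubsets.hrushovskiProperty hM, EqSubsets.amenable_aut hM.ultrahomogeneous
    (EqSubsets.hrushovskiProperty hM)⟩, ?_, ?_, ?_⟩
  · rintro ⟨o, -, h⟩
    exact EqSubsets.not_ramseyProperty_age_orderExpansion (S := {n | 0 < n}) Nat.two_pos hM o h
  · let : EqSubsets.L₁₂.Structure M := EqSubsets.incl.reduct M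
    exact EqSubsets.amenable_aut hM'.ultrahomogeneous (EqSubsets.hrushovskiProperty hM')
  · let : EqSubsets.L₁₂.Structure M := EqSubsets.incl.reduct M
    rintro ⟨o, -, h⟩
    exact EqSubsets.not_ramseyProperty_age_orderExpansion (Or.inr rfl) hM' o h
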